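/- Let $M$ be a smooth $m$-dimensional manifold with tangent bundle $\pi:TM\to M$, and let $(x^i,v^j)$ denote the charts of $TM$ induced by charts $(x^i)$ of $M$. Let $\xi=\sum_i v^i\,\partial_{v^i}$ be the tautological vector field of $TM$ and let $B=\sum_j dx^j\otimes\partial_{v^j}$ be the mirror map, i.e. the differential $d\pi$ followed by the vertical lift. Let $i_B$ be the degree-$0$ derivation $(i_B\eta)(X_1,\dots,X_p)=\sum_{k=1}^p\eta(X_1,\dots,BX_k,\dots,X_p)$, zero on functions, and let $d_B=[i_B,d]=i_B\circ d-d\circ i_B$. For a $p$-form $\omega=\sum_{i_1<\cdots<i_p} o_{i_1\cdots i_p}\,dx^{i_1}\wedge\cdots\wedge dx^{i_p}$ on $M$ let $\widetilde\omega$ be its complete lift, the $p$-form on $TM$ given locally by $$\widetilde\omega=\sum_{i_1<\cdots<i_p}\Big(\sum_j v^j\frac{\partial o_{i_1\cdots i_p}}{\partial x^j}\,dx^{i_1}\wedge\cdots\wedge dx^{i_p}+o_{i_1\cdots i_p}\sum_{k=1}^p dx^{i_1}\wedge\cdots\wedge dv^{i_k}\wedge\cdots\wedge dx^{i_p}\Big).$$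 The interior product $\xi\lrcorner\eta=\eta(\xi,\cdot,\dots,\cdot)$ is $0$ on functions. Then, for every smooth $p$-form $\omega$ on $M$, $p\ge 0$, the form $\widetilde\omega$ is smooth, and: (i) if $p\geq 1$, then $\xi\lrcorner\widetilde\omega$ is smooth and $d_B(\xi\lrcorner\widetilde\omega)=p\,\pi^*\omega$; in particular $\pi^*\omega=d_B\eta$ for some smooth $(p-1)$-form $\eta$ on $TM$, i.e. $\pi^*\omega$ vanishes in $d_B$-cohomology; (ii) $d_B\widetilde\omega=d\,\pi^*\omega$; (iii) if $d\omega=0$, then $d(\xi\lrcorner\widetilde\omega)=\widetilde\omega$; for $p=0$ this reads: if $df=0$, then $\widetilde f=0$. -/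

import Mathlib

open scoped Manifold ContDiff Bundle
open Set

noncomputable section

namespace TangentForms

section Forms

variable {E : Type*} [NormedAddCommGroup E] [NormedSpace ℝ E]
  {H : Type*} [TopologicalSpace H] (I : ModelWithCorners ℝ E H)
  (N : Type*) [TopologicalSpace N] [ChartedSpace H N]

/-- A (not necessarily smooth) differential `p`-form on the manifold `N`: an alternating
`p`-linear form on each tangent space. -/
abbrev Form (p : ℕ) : Type _ := ∀ x : N, TangentSpace I x [⋀^Fin p]→L[ℝ] ℝ

/-- A field of endomorphisms of the tangent spaces of `N`, that is, a `(1,1)`-tensor field. -/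
abbrev EndField : Type _ := ∀ x : N, TangentSpace I x →L[ℝ] TangentSpace I x

variable {I N}

/-- The coordinate expression of the form `α` in the chart around `x₀`: the pullback of `α` by the
inverse of the chart. Only its values on the target of the chart are meaningful. -/
def Form.inChart {p : ℕ} (α : Form I N p) (x₀ : N) : E → E [⋀^Fin p]→L[ℝ] ℝ := fun y =>
  (α ((extChartAt I x₀).symm y)).compContinuousLinearMap
    (mfderivWithin 𝓘(ℝ, E) I (extChartAt I x₀).symm (range I) y)

/-- A form is smooth if its coordinate expressions in all charts are. -/
def Form.IsSmooth {p : ℕ} (α : Form I N p) : Prop :=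
  ∀ x₀ : N, ContDiffOn ℝ ∞ (α.inChart x₀) (extChartAt I x₀).target

/-- The exterior derivative, computed at `x` in the chart around `x`. -/
def Form.d {p : ℕ} (α : Form I N p) : Form I N (p + 1) := fun x =>
  (extDerivWithin (α.inChart x) (range I) (extChartAt I x x)).compContinuousLinearMap
    (mfderiv I 𝓘(ℝ, E) (extChartAt I x) x)

/-- The interior product `X ⌟ α = α(X, ·, …, ·)`. -/
def Form.interior {p : ℕ} (X : ∀ x : N, TangentSpace I x) (α : Form I N (p + 1)) : Form I N p :=
  fun x => ContinuousAlternatingMap.curryLeft (E := E) (α x) (X x)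

/-- The algebraic derivation `i_K` of degree `0` defined by a vector valued `1`-form `K`:
`(i_K α)(X₁, …, X_p) = ∑ i, α(X₁, …, K X_i, …, X_p)`, see `Form.insert_apply`. -/
def Form.insert {p : ℕ} (K : EndField I N) (α : Form I N p) : Form I N p := fun x =>
  ContinuousAlternatingMap.fderivCompContinuousLinearMap (E := E) (F := E) (α x)
    (ContinuousLinearMap.id ℝ E) (K x)

theorem Form.insert_apply {p : ℕ} (K : EndField I N) (α : Form I N p) (x : N)
    (X : Fin p → TangentSpace I x) :
    α.insert K x X = ∑ i, α x (Function.update X i (K x (X i))) := by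
  refine (ContinuousAlternatingMap.fderivCompContinuousLinearMap_apply
    (E := E) (F := E) (α x) (ContinuousLinearMap.id ℝ E) (K x) X).trans ?_
  refine Finset.sum_congr rfl fun i _ => congrArg (α x) (funext fun j => ?_)
  rcases eq_or_ne j i with rfl | h
  · rw [Function.update_self]
    exact congrArg (fun T : E →L[ℝ] E => T (X j)) (Function.update_self ..)
  · rw [Function.update_of_ne h]
    have e : Function.update (fun _ : Fin p => ContinuousLinearMap.id ℝ E) i (K x) j =
        ContinuousLinearMap.id ℝ E := Function.update_of_ne h _ _
    exact congrArg (fun T : E →L[ℝ] E => T (X j)) e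

/-- The Lie derivation `L_K = [i_K, d] = i_K ∘ d - d ∘ i_K` of degree `1` defined by a vector valued
`1`-form `K`. -/
def Form.lieDeriv {p : ℕ} (K : EndField I N) (α : Form I N p) : Form I N (p + 1) :=
  α.d.insert K - (α.insert K).d

end Forms

section Tangent

variable {E : Type*} [NormedAddCommGroup E] [NormedSpace ℝ E]
  {H : Type*} [TopologicalSpace H] {I : ModelWithCorners ℝ E H}
  {M : Type*} [TopologicalSpace M] [ChartedSpace H M] [IsManifold I 1 M]

/-- The vertical lift `T_x M → T_u (TM)`, `x = π u`: the derivative at `u` of the inclusion into `TM`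
of the fibre `T_x M`. -/
def verticalLift (u : TangentBundle I M) : TangentSpace I u.proj →L[ℝ] TangentSpace I.tangent u :=
  mfderiv 𝓘(ℝ, E) I.tangent (fun v : E => (⟨u.proj, v⟩ : TangentBundle I M)) u.snd

variable (I M) in
/-- The tautological (Liouville) vector field `ξ` of `TM`: the vertical lift of `u` at `u`. -/
def tautological : ∀ u : TangentBundle I M, TangentSpace I.tangent u :=
  fun u => verticalLift u u.snd

variable (I M) in
/-- The mirror map `B` of `TM`: the differential of the projection followed by the vertical lift. -/
def mirror : EndField I.tangent (TangentBundle I M) := fun u =>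
  verticalLift u ∘L
    mfderiv I.tangent I (Bundle.TotalSpace.proj : TangentBundle I M → M) u

/-- The derivation `d_B = L_B` on the forms of `TM`. -/
def dB {p : ℕ} (η : Form I.tangent (TangentBundle I M) p) :
    Form I.tangent (TangentBundle I M) (p + 1) :=
  η.lieDeriv (mirror I M)

/-- The pullback `π*α` by the projection `π : TM → M`. -/
def pullback {p : ℕ} (α : Form I M p) : Form I.tangent (TangentBundle I M) p := fun u =>
  (α u.proj).compContinuousLinearMap
    (mfderiv I.tangent I (Bundle.TotalSpace.proj : TangentBundle I M → M) u)

/-- The coordinate expression of the complete lift of `α` in the chart `(x, v)` of `TM` induced by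
the chart of `M` around `x₀`. If `α = ∑ o_J dx^J`, it is `∑ v^j ∂_j o_J dx^J` plus
`∑ o_J (dv^{j₁} ∧ dx^{j₂} ∧ ⋯ + ⋯ + dx^{j₁} ∧ ⋯ ∧ dv^{j_p})`; the second part sends
`((a₁, b₁), …, (a_p, b_p))` to `∑ i, o(a₁, …, b_i, …, a_p)`. -/
def completeLiftInChart {p : ℕ} (α : Form I M p) (x₀ : M) :
    E × E → (E × E) [⋀^Fin p]→L[ℝ] ℝ := fun z =>
  (fderivWithin ℝ (α.inChart x₀) (range I) z.1 z.2).compContinuousLinearMap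
      (ContinuousLinearMap.fst ℝ E E) +
    (α.inChart x₀ z.1).fderivCompContinuousLinearMap
      (ContinuousLinearMap.fst ℝ E E) (ContinuousLinearMap.snd ℝ E E)

/-- The complete lift of `α` to `TM`, given at `u` by the coordinate expression in the
chart of `TM` around `u`, the one induced by the chart of `M` around `π u`. -/
def completeLift {p : ℕ} (α : Form I M p) : Form I.tangent (TangentBundle I M) p := fun u =>
  (completeLiftInChart α u.proj (extChartAt I.tangent u u)).compContinuousLinearMap
    (mfderiv I.tangent 𝓘(ℝ, E × E) (extChartAt I.tangent u) u)

end Tangent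

end TangentForms

end

open scoped Topology

noncomputable section

namespace TangentForms

/-! ### Local model: forms on a vector space and their lifts to `E × E` -/

section VectorSpace

/-! In an induced chart `(x, v)`, if `η` represents `ω`, then `liftForm η`, `contractForm η` and
`pullForm η` represent the complete lift, its contraction with `ξ`, and `π*ω`; `B` becomes the
constant map `(a, b) ↦ (0, a)`. Write `L`, `C`, `P` for the three operations. Everything follows
from Cartan's formula `d C η = L η - C dη` (`extDeriv_contractForm`) and two algebraic facts: `i_B C
η = 0`, since `C η` ignores vertical components, and `i_B L η = p P η`.

Since `d² = 0`, Cartan's formula gives `d L η = L dη`. Hence, for `η` of degree `p ≥ 1`, `d_B C η =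
i_B (L η - C dη) = p P η`. In every degree, `d_B L η = i_B L dη - p d P η = (p + 1) P dη - p P dη =
P dη`. If `dη = 0`, Cartan's formula reads `d C η = L η`; in degree `0`, `L f = C df` vanishes.

The geometric input is `completeLift_inChart`: the lift, defined at each point by that point's own
chart, has the same coordinate formula throughout any induced chart. This rests on the symmetry of
second derivatives of transition maps (`liftForm_pullback`). -/

theorem two_le_infty : (2 : WithTop ℕ∞) ≤ ∞ := by
  exact WithTop.coe_le_coe.2 (le_top : (2 : ℕ∞) ≤ ⊤)

variable {E : Type*} [NormedAddCommGroup E] [NormedSpace ℝ E] {p : ℕ}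

theorem fderivCompContinuousLinearMap_apply_update {F : Type*} [NormedAddCommGroup F]
    [NormedSpace ℝ F] (f : F [⋀^Fin p]→L[ℝ] ℝ) (g dg : E →L[ℝ] F) (X : Fin p → E) :
    f.fderivCompContinuousLinearMap g dg X =
      ∑ i, f (Function.update (fun j => g (X j)) i (dg (X i))) := by
  rw [ContinuousAlternatingMap.fderivCompContinuousLinearMap_apply]
  refine Finset.sum_congr rfl fun i _ => congrArg f (funext fun j => ?_)
  rcases eq_or_ne j i with rfl | h <;> simp [*]

/-- The complete lift of a form on a vector space. -/
def liftForm (η : E → E [⋀^Fin p]→L[ℝ] ℝ) : E × E → (E × E) [⋀^Fin p]→L[ℝ] ℝ := fun z =>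
  (fderiv ℝ η z.1 z.2).compContinuousLinearMap (ContinuousLinearMap.fst ℝ E E) +
    (η z.1).fderivCompContinuousLinearMap
      (ContinuousLinearMap.fst ℝ E E) (ContinuousLinearMap.snd ℝ E E)

/-- The contraction of (the pullback of) a form on a vector space with the fibre coordinate. -/
def contractForm (η : E → E [⋀^Fin (p + 1)]→L[ℝ] ℝ) : E × E → (E × E) [⋀^Fin p]→L[ℝ] ℝ := fun z =>
  ((η z.1).curryLeft z.2).compContinuousLinearMap (ContinuousLinearMap.fst ℝ E E)

/-- The pullback of a form on a vector space to the tangent bundle. -/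
def pullForm (η : E → E [⋀^Fin p]→L[ℝ] ℝ) : E × E → (E × E) [⋀^Fin p]→L[ℝ] ℝ := fun z =>
  (η z.1).compContinuousLinearMap (ContinuousLinearMap.fst ℝ E E)

variable (E) in
/-- The mirror map of a vector space. -/
def mirrorModel : E × E →L[ℝ] E × E :=
  ContinuousLinearMap.inr ℝ E E ∘L ContinuousLinearMap.fst ℝ E E

theorem liftForm_apply (η : E → E [⋀^Fin p]→L[ℝ] ℝ) (z : E × E) (X : Fin p → E × E) :
    liftForm η z X = fderiv ℝ η z.1 z.2 (fun i => (X i).1) +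
      ∑ i, η z.1 (Function.update (fun j => (X j).1) i (X i).2) := by
  rw [liftForm, ContinuousAlternatingMap.add_apply, fderivCompContinuousLinearMap_apply_update]
  rfl

theorem contractForm_apply (η : E → E [⋀^Fin (p + 1)]→L[ℝ] ℝ) (z : E × E) (X : Fin p → E × E) :
    contractForm η z X = η z.1 (Matrix.vecCons z.2 fun i => (X i).1) := rfl

theorem pullForm_apply (η : E → E [⋀^Fin p]→L[ℝ] ℝ) (z : E × E) (X : Fin p → E × E) :
    pullForm η z X = η z.1 (fun i => (X i).1) := rfl

theorem liftForm_congr {η η' : E → E [⋀^Fin p]→L[ℝ] ℝ} {z : E × E} (h : η =ᶠ[𝓝 z.1] η') :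
    liftForm η z = liftForm η' z := by
  rw [liftForm, liftForm, h.fderiv_eq, h.eq_of_nhds]

/-- The complete lift commutes with pullbacks. -/
theorem liftForm_pullback {η : E → E [⋀^Fin p]→L[ℝ] ℝ} {τ : E → E} {z : E × E}
    (hτ : ContDiffAt ℝ 2 τ z.1) (hη : DifferentiableAt ℝ η (τ z.1)) :
    liftForm (fun y => (η (τ y)).compContinuousLinearMap (fderiv ℝ τ y)) z =
      (liftForm η (τ z.1, fderiv ℝ τ z.1 z.2)).compContinuousLinearMap
        (fderiv ℝ (fun w : E × E => (τ w.1, fderiv ℝ τ w.1 w.2)) z) := by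
  have hτ1 : HasFDerivAt τ (fderiv ℝ τ z.1) z.1 :=
    (hτ.differentiableAt two_ne_zero).hasFDerivAt
  have hτ2 : HasFDerivAt (fderiv ℝ τ) (fderiv ℝ (fderiv ℝ τ) z.1) z.1 :=
    ((hτ.fderiv_right (m := 1) (by norm_num)).differentiableAt one_ne_zero).hasFDerivAt
  -- Differentiating the pulled back form along `v` produces `D²τ(v, Xᵢ)`, while the tangent map of
  -- `τ` produces `D²τ(Xᵢ, v)`; symmetry identifies them.
  have hsymm : IsSymmSndFDerivAt ℝ τ z.1 := hτ.isSymmSndFDerivAt (by simp)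
  have h1 := (hη.hasFDerivAt.comp z.1 hτ1).continuousAlternatingMapCompContinuousLinearMap hτ2
  have hfst : HasFDerivAt (Prod.fst : E × E → E) (ContinuousLinearMap.fst ℝ E E) z := hasFDerivAt_fst
  have hsnd : HasFDerivAt (Prod.snd : E × E → E) (ContinuousLinearMap.snd ℝ E E) z := hasFDerivAt_snd
  have h2 := (hτ1.comp z hfst).prodMk ((hτ2.comp z hfst).clm_apply hsnd)
  have h1' : fderiv ℝ (fun y => (η (τ y)).compContinuousLinearMap (fderiv ℝ τ y)) z.1 = _ :=
    h1.fderiv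
  have h2' : fderiv ℝ (fun w : E × E => (τ w.1, fderiv ℝ τ w.1 w.2)) z = _ := h2.fderiv
  ext X
  rw [liftForm_apply, h1', h2', ContinuousAlternatingMap.compContinuousLinearMap_apply,
    liftForm_apply]
  simp only [add_apply, ContinuousAlternatingMap.add_apply,
    ContinuousLinearMap.comp_apply, fderivCompContinuousLinearMap_apply_update,
    Function.comp_apply, ContinuousLinearMap.prod_apply, ContinuousLinearMap.flip_apply,
    ContinuousLinearMap.coe_fst', ContinuousLinearMap.coe_snd',
    ContinuousAlternatingMap.map_update_add, Finset.sum_add_distrib, add_assoc,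
    ContinuousAlternatingMap.compContinuousLinearMap_apply]
  congr 1
  rw [add_comm]
  congr 1
  · refine Finset.sum_congr rfl fun i _ => congrArg _ (funext fun j => ?_)
    rcases eq_or_ne j i with rfl | h <;> simp [*]
  · refine Finset.sum_congr rfl fun i _ => ?_
    rw [hsymm.eq]

theorem contDiffOn_liftForm {η : E → E [⋀^Fin p]→L[ℝ] ℝ} {s : Set E} (hs : IsOpen s)
    (hη : ContDiffOn ℝ ∞ η s) : ContDiffOn ℝ ∞ (liftForm η) (s ×ˢ univ) := by
  have hm : MapsTo (Prod.fst : E × E → E) (s ×ˢ univ) s := fun z hz => hz.1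
  have h1 : ContDiffOn ℝ ∞ (fun z : E × E => fderiv ℝ η z.1 z.2) (s ×ˢ univ) :=
    ((hη.fderiv_of_isOpen hs (by simp)).comp contDiffOn_fst hm).clm_apply contDiffOn_snd
  have h2 : ContDiffOn ℝ ∞ (fun z : E × E => η z.1) (s ×ˢ univ) := hη.comp contDiffOn_fst hm
  refine ContDiffOn.add
    ((ContinuousAlternatingMap.compContinuousLinearMapCLM (F := ℝ) (ι := Fin p)
      (ContinuousLinearMap.fst ℝ E E)).contDiff.comp_contDiffOn h1) ?_
  exact (((ContinuousAlternatingMap.fderivCompContinuousLinearMapCLM ℝ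
    (ContinuousLinearMap.fst ℝ E E)).contDiff.comp_contDiffOn h2).clm_apply
      contDiffOn_const)

theorem contDiffOn_contractForm {η : E → E [⋀^Fin (p + 1)]→L[ℝ] ℝ} {s : Set E}
    (hη : ContDiffOn ℝ ∞ η s) : ContDiffOn ℝ ∞ (contractForm η) (s ×ˢ univ) := by
  have hm : MapsTo (Prod.fst : E × E → E) (s ×ˢ univ) s := fun z hz => hz.1
  have h2 : ContDiffOn ℝ ∞ (fun z : E × E => η z.1) (s ×ˢ univ) := hη.comp contDiffOn_fst hm
  exact (ContinuousAlternatingMap.compContinuousLinearMapCLM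
      (ContinuousLinearMap.fst ℝ E E)).contDiff.comp_contDiffOn
    ((ContinuousAlternatingMap.curryLeftLI.toContinuousLinearMap.contDiff.comp_contDiffOn
      h2).clm_apply contDiffOn_snd)

/-- Product rule: the contraction is bilinear in `η x` and `v`. Only the values of the derivative
matter later, so its expression stays hidden behind the existential. -/
theorem hasFDerivAt_contractForm {η : E → E [⋀^Fin (p + 1)]→L[ℝ] ℝ} {z : E × E}
    (hη : DifferentiableAt ℝ η z.1) :
    ∃ T : E × E →L[ℝ] (E × E) [⋀^Fin p]→L[ℝ] ℝ, HasFDerivAt (contractForm η) T z ∧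
      ∀ (w : E × E) (X : Fin p → E × E),
      T w X = fderiv ℝ η z.1 w.1 (Matrix.vecCons z.2 fun i => (X i).1) +
        η z.1 (Matrix.vecCons w.2 fun i => (X i).1) := by
  have h1 : HasFDerivAt (fun z : E × E => η z.1) _ z := hη.hasFDerivAt.comp z hasFDerivAt_fst
  have hl : HasFDerivAt (fun f : E [⋀^Fin (p + 1)]→L[ℝ] ℝ => f.curryLeft) _ (η z.1) :=
    (ContinuousAlternatingMap.curryLeftLI (𝕜 := ℝ) (E := E) (F := ℝ)
      (n := p)).toContinuousLinearMap.hasFDerivAt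
  have hc := HasFDerivAt.comp (g := fun f : E [⋀^Fin (p + 1)]→L[ℝ] ℝ => f.curryLeft) z hl h1
  have h2 := hc.clm_apply (hasFDerivAt_snd (𝕜 := ℝ) (E := E) (F := E) (p := z))
  have h3 := (ContinuousAlternatingMap.compContinuousLinearMapCLM (F := ℝ) (ι := Fin p)
      (ContinuousLinearMap.fst ℝ E E)).hasFDerivAt.comp z h2
  refine ⟨_, h3, fun w X => ?_⟩
  rw [add_comm]
  rfl

/-- Cartan's formula for the contraction with the fibre coordinate. -/
theorem extDeriv_contractForm {η : E → E [⋀^Fin (p + 1)]→L[ℝ] ℝ} {z : E × E}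
    (hη : DifferentiableAt ℝ η z.1) :
    extDeriv (contractForm η) z = liftForm η z - contractForm (extDeriv η) z := by
  obtain ⟨T, hT, hT'⟩ := hasFDerivAt_contractForm hη
  ext X
  rw [ContinuousAlternatingMap.sub_apply, liftForm_apply, contractForm_apply, extDeriv,
    hT.fderiv, extDeriv, ContinuousAlternatingMap.alternatizeUncurryFin_apply,
    ContinuousAlternatingMap.alternatizeUncurryFin_apply, Fin.sum_univ_succ (n := p + 1)]
  -- Moving the entry in slot `i` to the front costs `(-1)^i`, exactly the sign in the alternating
  -- sum defining `d`.
  have e1 : ∀ i : Fin (p + 1), η z.1 (Function.update (fun j => (X j).1) i (X i).2) =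
      (-1 : ℤ) ^ (i : ℕ) • η z.1 (Matrix.vecCons (X i).2 fun j => (i.removeNth X j).1) := by
    intro i
    rw [← ContinuousAlternatingMap.map_insertNth]
    congr 1
    rw [← Fin.insertNth_removeNth]
    rfl
  -- Here `v` occupies slot `0`, so slot `i` of `X` becomes slot `i + 1`; the extra sign makes these
  -- terms of `C dη` cancel against those of `d C η`.
  have e2 : ∀ i : Fin (p + 1), (i.succ.removeNth (Matrix.vecCons z.2 fun j => (X j).1)) =
      Matrix.vecCons z.2 fun j => (i.removeNth X j).1 := by
    intro i
    funext j
    refine Fin.cases ?_ (fun j => ?_) j <;> simp [Fin.removeNth]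
  simp only [hT', smul_add, Finset.sum_add_distrib, e1, e2]
  simp [pow_succ, Fin.removeNth, Matrix.vecCons]
  abel

theorem extDeriv_pullForm {η : E → E [⋀^Fin p]→L[ℝ] ℝ} {z : E × E}
    (hη : DifferentiableAt ℝ η z.1) :
    extDeriv (pullForm η) z = pullForm (extDeriv η) z := by
  have h := extDeriv_pullback (f := (Prod.fst : E × E → E)) (r := 2) (x := z)
    hη contDiffAt_fst (by simp)
  simp only [fderiv_fst] at h
  exact h

theorem contDiffOn_extDeriv {η : E → E [⋀^Fin p]→L[ℝ] ℝ} {s : Set E} (hs : IsOpen s)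
    (hη : ContDiffOn ℝ ∞ η s) : ContDiffOn ℝ ∞ (extDeriv η) s :=
  (ContinuousAlternatingMap.alternatizeUncurryFinCLM ℝ E ℝ).contDiff.comp_contDiffOn
    (hη.fderiv_of_isOpen hs (by simp))

/-- Both sides are `df(v)`. This replaces Cartan's formula in degree `0`, where `contractForm η`
does not exist. -/
theorem liftForm_eq_contractForm_extDeriv (η : E → E [⋀^Fin 0]→L[ℝ] ℝ) :
    liftForm η = contractForm (extDeriv η) := by
  funext z
  ext X
  rw [liftForm_apply, contractForm_apply, extDeriv,
    ContinuousAlternatingMap.alternatizeUncurryFin_apply]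
  simp only [Finset.univ_eq_empty, Finset.sum_empty, add_zero]
  simp

/-- The complete lift commutes with the exterior derivative. -/
theorem extDeriv_liftForm {η : E → E [⋀^Fin p]→L[ℝ] ℝ} {s : Set E} (hs : IsOpen s)
    (hη : ContDiffOn ℝ ∞ η s) {z : E × E} (hz : z.1 ∈ s) :
    extDeriv (liftForm η) z = liftForm (extDeriv η) z := by
  have hs' : IsOpen (s ×ˢ (univ : Set E)) := hs.prod isOpen_univ
  have hdη := contDiffOn_extDeriv hs hη
  have hd : ∀ y ∈ s, DifferentiableAt ℝ (extDeriv η) y := fun y hy =>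
    (hdη.contDiffAt (hs.mem_nhds hy)).differentiableAt (by simp)
  have hdd : ∀ y ∈ s, extDeriv (extDeriv η) y = 0 := fun y hy =>
    extDeriv_extDeriv_apply ((hη.contDiffAt (hs.mem_nhds hy)).of_le two_le_infty) (by simp)
  -- Cartan's formula for `dη`, whose last term vanishes because `d² = 0`.
  have h1 : extDeriv (contractForm (extDeriv η)) z = liftForm (extDeriv η) z := by
    rw [extDeriv_contractForm (hd _ hz), sub_eq_self]
    ext X
    rw [contractForm_apply, hdd _ hz]
    rfl
  cases p with
  | zero => rw [liftForm_eq_contractForm_extDeriv, h1]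
  | succ p =>
    -- Cartan's formula is needed on a neighbourhood because it is about to be differentiated; `d² =
    -- 0` then kills the first summand.
    have h2 : liftForm η =ᶠ[𝓝 z] extDeriv (contractForm η) + contractForm (extDeriv η) := by
      filter_upwards [hs'.mem_nhds (⟨hz, mem_univ _⟩ : z ∈ s ×ˢ (univ : Set E))] with w hw
      rw [Pi.add_apply, extDeriv_contractForm
        ((hη.contDiffAt (hs.mem_nhds hw.1)).differentiableAt (by simp)), sub_add_cancel]
    have hc := contDiffOn_contractForm hη
    have hz' := hs'.mem_nhds (⟨hz, mem_univ _⟩ : z ∈ s ×ˢ (univ : Set E))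
    rw [h2.extDeriv_eq, extDeriv_add, h1, extDeriv_extDeriv_apply
      ((hc.contDiffAt hz').of_le two_le_infty) (by simp),
      zero_add]
    · exact ((contDiffOn_extDeriv hs' hc).contDiffAt hz').differentiableAt (by simp)
    · exact ((contDiffOn_contractForm hdη).contDiffAt hz').differentiableAt (by simp)

/-- The mirror map takes vertical values, and the contraction sees only horizontal components: every
summand has a zero entry. -/
theorem insert_mirrorModel_contractForm (η : E → E [⋀^Fin (p + 1)]→L[ℝ] ℝ) (z : E × E) :
    (contractForm η z).fderivCompContinuousLinearMap (ContinuousLinearMap.id ℝ (E × E))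
      (mirrorModel E) = 0 := by
  ext X
  rw [fderivCompContinuousLinearMap_apply_update]
  refine Finset.sum_eq_zero fun i _ => ?_
  rw [contractForm_apply]
  exact (η z.1).map_coord_zero i.succ (by simp [mirrorModel])

/-- Replacing `Xᵢ = (aᵢ, bᵢ)` by `(0, aᵢ)` kills the derivative term and every term of the sum
except the `i`-th, which puts `aᵢ` back into slot `i`. Each of the `p` insertions thus gives
`pullForm η`. -/
theorem insert_mirrorModel_liftForm (η : E → E [⋀^Fin p]→L[ℝ] ℝ) (z : E × E) :
    (liftForm η z).fderivCompContinuousLinearMap (ContinuousLinearMap.id ℝ (E × E))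
      (mirrorModel E) = (p : ℝ) • pullForm η z := by
  ext X
  rw [fderivCompContinuousLinearMap_apply_update]
  have h : ∀ i, liftForm η z (Function.update
      (fun j => ContinuousLinearMap.id ℝ (E × E) (X j)) i (mirrorModel E (X i))) =
      pullForm η z X := by
    intro i
    rw [liftForm_apply, ContinuousAlternatingMap.map_coord_zero _ i (by simp [mirrorModel]),
      zero_add, Finset.sum_eq_single i]
    · rw [pullForm_apply]
      refine congrArg _ (funext fun j => ?_)
      rcases eq_or_ne j i with rfl | h <;> simp [*, mirrorModel]
    · intro k _ hk
      exact ContinuousAlternatingMap.map_coord_zero _ i (by simp [mirrorModel, hk.symm])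
    · simp
  rw [Finset.sum_congr rfl fun i _ => h i]
  simp

end VectorSpace

/-! ### Forms, insertions, contractions and `d` in the charts of a manifold -/

section Charts

variable {E : Type*} [NormedAddCommGroup E] [NormedSpace ℝ E]
  {H : Type*} [TopologicalSpace H] (I : ModelWithCorners ℝ E H)
  {N : Type*} [TopologicalSpace N] [ChartedSpace H N] {p : ℕ}

/-- The derivative of the inverse of the chart around `x₀`, as a map of the model space. -/
def symmD (x₀ : N) (y : E) : E →L[ℝ] E :=
  mfderivWithin 𝓘(ℝ, E) I (extChartAt I x₀).symm (range I) y

/-- The derivative of the chart around `x₀`, as a map of the model space. -/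
def chartD (x₀ x : N) : E →L[ℝ] E := mfderiv I 𝓘(ℝ, E) (extChartAt I x₀) x

variable {I}

/-- The value of a form at a point, as a form on the model space. -/
def Form.value (α : Form I N p) (x : N) : E [⋀^Fin p]→L[ℝ] ℝ := α x

/-- The value of a field of endomorphisms at a point, as a map of the model space. -/
def endValue (K : EndField I N) (x : N) : E →L[ℝ] E := K x

theorem Form.ext_value {α β : Form I N p} (h : ∀ x, α.value x = β.value x) : α = β := funext h

theorem Form.inChart_eq (α : Form I N p) (x₀ : N) (y : E) :
    α.inChart x₀ y =
      (α.value ((extChartAt I x₀).symm y)).compContinuousLinearMap (symmD I x₀ y) := rfl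

theorem Form.IsSmooth.const_smul {α : Form I N p} (hα : α.IsSmooth) (c : ℝ) :
    Form.IsSmooth (c • α) :=
  fun x₀ => (hα x₀).const_smul c

theorem Form.IsSmooth.differentiableAt_inChart [I.Boundaryless] {α : Form I N p}
    (hα : α.IsSmooth) (x : N) : DifferentiableAt ℝ (α.inChart x) (extChartAt I x x) :=
  ((hα x).contDiffAt (extChartAt_target_mem_nhds x)).differentiableAt (by simp)

variable [IsManifold I 1 N]

theorem chartD_comp_symmD {x₀ : N} {y : E} (hy : y ∈ (extChartAt I x₀).target) :
    chartD I x₀ ((extChartAt I x₀).symm y) ∘L symmD I x₀ y = ContinuousLinearMap.id ℝ E :=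
  mfderiv_extChartAt_comp_mfderivWithin_extChartAt_symm hy

theorem symmD_comp_chartD {x₀ : N} {y : E} (hy : y ∈ (extChartAt I x₀).target) :
    symmD I x₀ y ∘L chartD I x₀ ((extChartAt I x₀).symm y) = ContinuousLinearMap.id ℝ E :=
  mfderivWithin_extChartAt_symm_comp_mfderiv_extChartAt hy

/-- The tangent space at `x` is the model space `E` read through the preferred chart at `x`, so that
chart has identity derivative there. -/
theorem chartD_self (x : N) : chartD I x x = ContinuousLinearMap.id ℝ E := mfderiv_extChartAt_self

theorem symmD_self (x : N) : symmD I x (extChartAt I x x) = ContinuousLinearMap.id ℝ E :=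
  mfderivWithin_range_extChartAt_symm

theorem Form.value_eq_inChart (α : Form I N p) (x : N) :
    α.value x = α.inChart x (extChartAt I x x) := by
  rw [Form.inChart_eq, symmD_self, extChartAt_to_inv]
  rfl

theorem Form.inChart_insert {K : EndField I N} {K₀ : E →L[ℝ] E} (α : Form I N p) {x₀ : N} {y : E}
    (hy : y ∈ (extChartAt I x₀).target)
    (hK : chartD I x₀ ((extChartAt I x₀).symm y) ∘L
      endValue K ((extChartAt I x₀).symm y) ∘L symmD I x₀ y = K₀) :
    (α.insert K).inChart x₀ y =
      (α.inChart x₀ y).fderivCompContinuousLinearMap (ContinuousLinearMap.id ℝ E) K₀ := by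
  set x := (extChartAt I x₀).symm y with hx
  set L : E →L[ℝ] E := endValue K x with hL
  -- Insertion commutes with pullback along any map intertwining the two endomorphisms.
  have h : symmD I x₀ y ∘L K₀ = L ∘L symmD I x₀ y := by
    rw [← hK, ← ContinuousLinearMap.comp_assoc, symmD_comp_chartD hy, ContinuousLinearMap.id_comp]
  have h1 : (α.insert K).inChart x₀ y = ((α.value x).fderivCompContinuousLinearMap
    (ContinuousLinearMap.id ℝ E) L).compContinuousLinearMap (symmD I x₀ y) := rfl
  rw [h1, α.inChart_eq]
  ext X
  rw [ContinuousAlternatingMap.compContinuousLinearMap_apply,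
    fderivCompContinuousLinearMap_apply_update, fderivCompContinuousLinearMap_apply_update]
  refine Finset.sum_congr rfl fun i _ => ?_
  rw [ContinuousAlternatingMap.compContinuousLinearMap_apply]
  refine congrArg _ (funext fun j => ?_)
  rcases eq_or_ne j i with rfl | hj
  · simpa using (congrArg (fun T : E →L[ℝ] E => T (X j)) h).symm
  · simp [hj]

theorem Form.inChart_interior {X : ∀ x : N, TangentSpace I x} {v : E} (α : Form I N (p + 1))
    {x₀ : N} {y : E} (hy : y ∈ (extChartAt I x₀).target)
    (hX : chartD I x₀ ((extChartAt I x₀).symm y) (X ((extChartAt I x₀).symm y) : E) = v) :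
    (α.interior X).inChart x₀ y = (α.inChart x₀ y).curryLeft v := by
  set x := (extChartAt I x₀).symm y with hx
  have h : symmD I x₀ y v = (X x : E) := by
    rw [← hX]
    exact congrArg (fun T : E →L[ℝ] E => T (X x)) (symmD_comp_chartD hy)
  rw [α.inChart_eq, ContinuousAlternatingMap.curryLeft_compContinuousLinearMap, h]
  rfl

variable [I.Boundaryless]

theorem chartD_comp_symmD_eq_fderiv {x x₀ : N} {y : E} (hy : y ∈ (extChartAt I x₀).target)
    (hx : (extChartAt I x₀).symm y ∈ (extChartAt I x).source) :
    chartD I x ((extChartAt I x₀).symm y) ∘L symmD I x₀ y =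
      fderiv ℝ (extChartAt I x ∘ (extChartAt I x₀).symm) y := by
  rw [extChartAt_source] at hx
  have h1 := mdifferentiableWithinAt_extChartAt_symm hy
  have h2 : MDifferentiableAt I 𝓘(ℝ, E) (extChartAt I x) ((extChartAt I x₀).symm y) :=
    mdifferentiableAt_extChartAt hx
  rw [I.range_eq_univ, mdifferentiableWithinAt_univ] at h1
  have h3 := mfderiv_comp y h2 h1
  rw [mfderiv_eq_fderiv] at h3
  rw [h3, symmD, I.range_eq_univ, mfderivWithin_univ]
  rfl

theorem symmD_comp_fderiv {x x₀ : N} {y : E} (hy : y ∈ (extChartAt I x₀).target)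
    (hx : (extChartAt I x₀).symm y ∈ (extChartAt I x).source) :
    symmD I x (extChartAt I x ((extChartAt I x₀).symm y)) ∘L
      fderiv ℝ (extChartAt I x ∘ (extChartAt I x₀).symm) y = symmD I x₀ y := by
  have h := symmD_comp_chartD ((extChartAt I x).map_source hx)
  rw [(extChartAt I x).left_inv hx] at h
  rw [← chartD_comp_symmD_eq_fderiv hy hx, ← ContinuousLinearMap.comp_assoc, h,
    ContinuousLinearMap.id_comp]

/-- The coordinate expressions of a form in two charts are related by the transition map. -/
theorem Form.inChart_change (α : Form I N p) {x x₀ : N} {y : E}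
    (hy : y ∈ (extChartAt I x₀).target)
    (hx : (extChartAt I x₀).symm y ∈ (extChartAt I x).source) :
    α.inChart x₀ y =
      (α.inChart x ((extChartAt I x ∘ (extChartAt I x₀).symm) y)).compContinuousLinearMap
        (fderiv ℝ (extChartAt I x ∘ (extChartAt I x₀).symm) y) := by
  rw [α.inChart_eq, α.inChart_eq, ← symmD_comp_fderiv hy hx, Function.comp_apply,
    (extChartAt I x).left_inv hx]
  rfl

/-- Since `d` at `x` uses the chart centred at `x`, whose derivative there is the identity, any
local formula for `α` in that chart may be differentiated directly. -/
theorem Form.d_value (α : Form I N p) {x : N} {β : E → E [⋀^Fin p]→L[ℝ] ℝ}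
    (h : α.inChart x =ᶠ[𝓝 (extChartAt I x x)] β) :
    α.d.value x = extDeriv β (extChartAt I x x) := by
  have h1 : α.d.value x = (extDerivWithin (α.inChart x) (range I)
    (extChartAt I x x)).compContinuousLinearMap (chartD I x x) := rfl
  rw [h1, chartD_self, I.range_eq_univ, extDerivWithin_univ, h.extDeriv_eq]
  rfl

end Charts

/-! ### The tangent bundle: induced charts and coordinate expressions of the lifts -/

section Tangent

variable {E : Type*} [NormedAddCommGroup E] [NormedSpace ℝ E]
  {H : Type*} [TopologicalSpace H] {I : ModelWithCorners ℝ E H}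
  {M : Type*} [TopologicalSpace M] [ChartedSpace H M] {p : ℕ}

section

variable [IsManifold I 1 M]

theorem mem_tangent_target {u₀ : TangentBundle I M} {z : E × E} :
    z ∈ (extChartAt I.tangent u₀).target ↔ z.1 ∈ (extChartAt I u₀.proj).target := by
  rw [FiberBundle.extChartAt_target]
  refine ⟨fun h => h.1.1, fun h => ⟨⟨h, ?_⟩, mem_univ _⟩⟩
  have := (extChartAt I u₀.proj).map_target h
  rwa [extChartAt_source] at this

theorem tangent_target_eq (u₀ : TangentBundle I M) :
    (extChartAt I.tangent u₀).target = (extChartAt I u₀.proj).target ×ˢ univ := by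
  ext z
  rw [mem_tangent_target]
  simp

theorem mem_tangent_source {u u₀ : TangentBundle I M} :
    u ∈ (extChartAt I.tangent u₀).source ↔ u.proj ∈ (extChartAt I u₀.proj).source := by
  rw [extChartAt_source, extChartAt_source]
  exact TangentBundle.mem_chart_source_iff u u₀

theorem tangent_symm_proj (u₀ : TangentBundle I M) (z : E × E) :
    ((extChartAt I.tangent u₀).symm z).proj = (extChartAt I u₀.proj).symm z.1 := rfl

/-- The fibre coordinate is the coordinate change from the preferred chart at `u.proj`, which is the
derivative of the base chart: the induced chart is `(x, v) ↦ (φ x, dφ v)`. -/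
theorem tangent_extChartAt {u u₀ : TangentBundle I M}
    (hu : u.proj ∈ (extChartAt I u₀.proj).source) :
    extChartAt I.tangent u₀ u =
      (extChartAt I u₀.proj u.proj, chartD I u₀.proj u.proj u.snd) := by
  rw [extChartAt_source] at hu
  have h : chartD I u₀.proj u.proj = tangentCoordChange I u.proj u₀.proj u.proj :=
    (TangentBundle.continuousLinearMapAt_trivializationAt hu).symm.trans
      (TangentBundle.continuousLinearMapAt_trivializationAt_eq_core hu)
  rw [h]
  rfl

theorem chartD_tangent_symm_snd {u₀ : TangentBundle I M} {z : E × E}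
    (hz : z ∈ (extChartAt I.tangent u₀).target) :
    chartD I u₀.proj ((extChartAt I u₀.proj).symm z.1) ((extChartAt I.tangent u₀).symm z).snd =
      z.2 := by
  have h := tangent_extChartAt (mem_tangent_source.1 ((extChartAt I.tangent u₀).map_target hz))
  rw [(extChartAt I.tangent u₀).right_inv hz] at h
  exact (congrArg Prod.snd h).symm

theorem tangent_symm_snd {u₀ : TangentBundle I M} {z : E × E}
    (hz : z ∈ (extChartAt I.tangent u₀).target) :
    ((extChartAt I.tangent u₀).symm z).snd = symmD I u₀.proj z.1 z.2 := by
  have h := symmD_comp_chartD (mem_tangent_target.1 hz)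
  have h' := congrArg (fun T : E →L[ℝ] E => T ((extChartAt I.tangent u₀).symm z).snd) h
  rw [← chartD_tangent_symm_snd hz]
  exact h'.symm

/-- The transition maps of the tangent bundle. -/
theorem tangent_transition [I.Boundaryless] {u u₀ : TangentBundle I M} {z : E × E}
    (hz : z.1 ∈ (extChartAt I u₀.proj).target)
    (hu : (extChartAt I u₀.proj).symm z.1 ∈ (extChartAt I u.proj).source) :
    (extChartAt I.tangent u ∘ (extChartAt I.tangent u₀).symm) z =
      ((extChartAt I u.proj ∘ (extChartAt I u₀.proj).symm) z.1,
        fderiv ℝ (extChartAt I u.proj ∘ (extChartAt I u₀.proj).symm) z.1 z.2) := by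
  rw [Function.comp_apply, tangent_extChartAt (by rwa [tangent_symm_proj]),
    tangent_symm_snd (mem_tangent_target.2 hz), ← chartD_comp_symmD_eq_fderiv hz hu]
  rfl

end

section

variable [IsManifold I ∞ M]

instance : IsManifold I.tangent 1 (TangentBundle I M) :=
  .of_le (n := ∞) (by simp)

/-- The derivative of the projection, as a map of the model spaces. -/
def projD (u : TangentBundle I M) : E × E →L[ℝ] E :=
  mfderiv I.tangent I (Bundle.TotalSpace.proj : TangentBundle I M → M) u

/-- The vertical lift, as a map of the model spaces. -/
def vertD (u : TangentBundle I M) : E →L[ℝ] E × E := verticalLift u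

theorem projD_comp_symmD [I.Boundaryless] {u₀ : TangentBundle I M} {z : E × E}
    (hz : z ∈ (extChartAt I.tangent u₀).target) :
    projD ((extChartAt I.tangent u₀).symm z) ∘L symmD I.tangent u₀ z =
      symmD I u₀.proj z.1 ∘L ContinuousLinearMap.fst ℝ E E := by
  have h1 := mdifferentiableWithinAt_extChartAt_symm hz
  have h2 := mdifferentiableWithinAt_extChartAt_symm (mem_tangent_target.1 hz)
  rw [ModelWithCorners.range_eq_univ, mdifferentiableWithinAt_univ] at h1 h2
  have h3 : MDifferentiableAt I.tangent I (Bundle.TotalSpace.proj : TangentBundle I M → M)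
    ((extChartAt I.tangent u₀).symm z) :=
    Bundle.mdifferentiableAt_proj _
  have h4 := mfderiv_comp z h3 h1
  have h5 := mfderiv_comp (I := 𝓘(ℝ, E × E)) z h2
    (mdifferentiableAt_iff_differentiableAt.2 (differentiableAt_fst (𝕜 := ℝ)))
  rw [mfderiv_eq_fderiv, fderiv_fst] at h5
  rw [symmD, symmD, ModelWithCorners.range_eq_univ, ModelWithCorners.range_eq_univ,
    mfderivWithin_univ, mfderivWithin_univ]
  -- Both are chain rules for one map: projecting after the inverse chart of `TM` is definitionally
  -- the inverse chart of `M` after `Prod.fst`.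
  exact h4.symm.trans h5

variable (I) in
/-- The inclusion of the fibre over `x` into the tangent bundle. -/
def fibreInclusion (x : M) (v : E) : TangentBundle I M := ⟨x, v⟩

theorem mdifferentiableAt_fibreInclusion (x : M) (v : E) :
    MDifferentiableAt 𝓘(ℝ, E) I.tangent (fibreInclusion I x) v :=
  (mdifferentiableAt_totalSpace I (fibreInclusion I x)).2
    ⟨mdifferentiableAt_const, mdifferentiableAt_iff_differentiableAt.2
      (tangentCoordChange I x x x).differentiableAt⟩

/-- On a fibre the induced chart is the affine map `v ↦ (φ x, dφ v)`, whose linear part is read off.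
-/
theorem chartD_comp_vertD {u u₀ : TangentBundle I M}
    (hu : u ∈ (extChartAt I.tangent u₀).source) :
    chartD I.tangent u₀ u ∘L vertD u =
      ContinuousLinearMap.inr ℝ E E ∘L chartD I u₀.proj u.proj := by
  obtain ⟨x, v⟩ := u
  change E at v
  have hu' := mem_tangent_source.1 hu
  rw [extChartAt_source] at hu
  have h2 : MDifferentiableAt I.tangent 𝓘(ℝ, E × E) (extChartAt I.tangent u₀)
    (fibreInclusion I x v) := mdifferentiableAt_extChartAt hu
  have h3 := mfderiv_comp v h2 (mdifferentiableAt_fibreInclusion x v)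
  have h4 : extChartAt I.tangent u₀ ∘ fibreInclusion I x =
      fun v => (extChartAt I u₀.proj x, chartD I u₀.proj x v) :=
    funext fun v => tangent_extChartAt (u := ⟨x, v⟩) hu'
  have h5 : HasFDerivAt (fun v : E => (extChartAt I u₀.proj x, chartD I u₀.proj x v))
      (ContinuousLinearMap.inr ℝ E E ∘L chartD I u₀.proj x) v :=
    (hasFDerivAt_const _ _).prodMk (chartD I u₀.proj x).hasFDerivAt
  rw [h4, mfderiv_eq_fderiv, h5.fderiv] at h3
  exact h3.symm

theorem tautological_inChart {u₀ : TangentBundle I M} {z : E × E}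
    (hz : z ∈ (extChartAt I.tangent u₀).target) :
    chartD I.tangent u₀ ((extChartAt I.tangent u₀).symm z)
      (tautological I M ((extChartAt I.tangent u₀).symm z)) = (0, z.2) := by
  have h := congrArg (fun T : E →L[ℝ] E × E => T ((extChartAt I.tangent u₀).symm z).snd)
    (chartD_comp_vertD ((extChartAt I.tangent u₀).map_target hz))
  exact h.trans (congrArg (Prod.mk (0 : E)) (chartD_tangent_symm_snd hz))

variable [I.Boundaryless]

theorem mirror_inChart {u₀ : TangentBundle I M} {z : E × E}
    (hz : z ∈ (extChartAt I.tangent u₀).target) :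
    chartD I.tangent u₀ ((extChartAt I.tangent u₀).symm z) ∘L
      endValue (mirror I M) ((extChartAt I.tangent u₀).symm z) ∘L symmD I.tangent u₀ z =
        mirrorModel E := by
  have h : endValue (mirror I M) ((extChartAt I.tangent u₀).symm z) =
    vertD ((extChartAt I.tangent u₀).symm z) ∘L projD ((extChartAt I.tangent u₀).symm z) := rfl
  rw [h, ContinuousLinearMap.comp_assoc, projD_comp_symmD hz, ← ContinuousLinearMap.comp_assoc,
    chartD_comp_vertD ((extChartAt I.tangent u₀).map_target hz), tangent_symm_proj,
    ContinuousLinearMap.comp_assoc,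
    ← ContinuousLinearMap.comp_assoc (chartD I u₀.proj _),
    chartD_comp_symmD (mem_tangent_target.1 hz), ContinuousLinearMap.id_comp]
  rfl

theorem pullback_inChart (α : Form I M p) {u₀ : TangentBundle I M} {z : E × E}
    (hz : z ∈ (extChartAt I.tangent u₀).target) :
    (pullback α).inChart u₀ z = pullForm (α.inChart u₀.proj) z := by
  have h : (pullback α).inChart u₀ z =
    (α.value ((extChartAt I u₀.proj).symm z.1)).compContinuousLinearMap
      (projD ((extChartAt I.tangent u₀).symm z) ∘L symmD I.tangent u₀ z) := rfl
  rw [h, projD_comp_symmD hz]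
  rfl

theorem completeLift_value (α : Form I M p) (u : TangentBundle I M) :
    (completeLift α).value u = liftForm (α.inChart u.proj) (extChartAt I.tangent u u) := by
  have h : (completeLift α).value u = (completeLiftInChart α u.proj
    (extChartAt I.tangent u u)).compContinuousLinearMap (chartD I.tangent u u) := rfl
  rw [h, chartD_self, completeLiftInChart, I.range_eq_univ, fderivWithin_univ]
  rfl

/-- Chart independence of the complete lift: the chart at the point and the chart at `u₀` differ by
the tangent map of a base transition `τ`, to which `liftForm_pullback` applies. -/
theorem completeLift_inChart {α : Form I M p} (hα : α.IsSmooth) {u₀ : TangentBundle I M}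
    {z : E × E} (hz : z ∈ (extChartAt I.tangent u₀).target) :
    (completeLift α).inChart u₀ z = liftForm (α.inChart u₀.proj) z := by
  set u := (extChartAt I.tangent u₀).symm z with hu
  have hz1 := mem_tangent_target.1 hz
  have hx : (extChartAt I u₀.proj).symm z.1 ∈ (extChartAt I u.proj).source :=
    mem_extChartAt_source u.proj
  set τ := extChartAt I u.proj ∘ (extChartAt I u₀.proj).symm with hτ
  have hs : ∀ᶠ y in 𝓝 z.1, y ∈ (extChartAt I u₀.proj).target ∧
      (extChartAt I u₀.proj).symm y ∈ (extChartAt I u.proj).source := by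
    refine ((isOpen_extChartAt_target u₀.proj).mem_nhds hz1 |> Filter.Eventually.and <|
      ((continuousOn_extChartAt_symm u₀.proj).continuousAt
        ((isOpen_extChartAt_target u₀.proj).mem_nhds hz1)).eventually
        ((isOpen_extChartAt_source u.proj).mem_nhds hx))
  have h1 : α.inChart u₀.proj =ᶠ[𝓝 z.1]
      fun y => (α.inChart u.proj (τ y)).compContinuousLinearMap (fderiv ℝ τ y) :=
    hs.mono fun y hy => α.inChart_change hy.1 hy.2
  have h2 : extChartAt I.tangent u ∘ (extChartAt I.tangent u₀).symm =ᶠ[𝓝 z]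
      fun w => (τ w.1, fderiv ℝ τ w.1 w.2) :=
    (continuous_fst.continuousAt.eventually hs).mono fun w hw => tangent_transition hw.1 hw.2
  have h3 : (completeLift α).inChart u₀ z =
      (liftForm (α.inChart u.proj) (extChartAt I.tangent u u)).compContinuousLinearMap
        (symmD I.tangent u₀ z) := by
    rw [Form.inChart_eq, ← hu, completeLift_value]
  -- The chart at `u` has identity derivative at `u`, so the inverse chart at `u₀` has the
  -- derivative of the transition map.
  have h4 : symmD I.tangent u₀ z =
      fderiv ℝ (fun w : E × E => (τ w.1, fderiv ℝ τ w.1 w.2)) z := by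
    rw [← h2.fderiv_eq, ← chartD_comp_symmD_eq_fderiv hz (mem_extChartAt_source u), ← hu,
      chartD_self, ContinuousLinearMap.id_comp]
  have hτs : ContDiffAt ℝ 2 τ z.1 := by
    have h := contDiffWithinAt_ext_coord_change (I := I) (n := ∞) u.proj u₀.proj (y := z.1)
      (by simpa only [PartialEquiv.trans_source, PartialEquiv.symm_source] using ⟨hz1, hx⟩)
    rw [I.range_eq_univ, contDiffWithinAt_univ] at h
    exact h.of_le two_le_infty
  have hαd : DifferentiableAt ℝ (α.inChart u.proj) (τ z.1) :=
    ((hα u.proj).contDiffAt ((isOpen_extChartAt_target u.proj).mem_nhds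
      ((extChartAt I u.proj).map_source hx))).differentiableAt (by simp)
  rw [h3, h4, liftForm_congr h1, liftForm_pullback hτs hαd, ← h2.eq_of_nhds]
  rfl

/-- In coordinates `ξ = (0, v)`. Its zero horizontal part in slot `0` kills every term of the lift
but the one placing `v` in that slot. -/
theorem interior_tautological_inChart {α : Form I M (p + 1)} (hα : α.IsSmooth)
    {u₀ : TangentBundle I M} {z : E × E} (hz : z ∈ (extChartAt I.tangent u₀).target) :
    ((completeLift α).interior (tautological I M)).inChart u₀ z =
      contractForm (α.inChart u₀.proj) z := by
  rw [Form.inChart_interior _ hz (tautological_inChart hz), completeLift_inChart hα hz]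
  ext X
  rw [ContinuousAlternatingMap.curryLeft_apply_apply, liftForm_apply,
    ContinuousAlternatingMap.map_coord_zero _ 0 (by simp), zero_add,
    Finset.sum_eq_single 0 _ (by simp), contractForm_apply]
  · refine congrArg _ (funext fun j => ?_)
    refine Fin.cases ?_ (fun j => ?_) j <;> simp
  · intro i _ hi
    exact ContinuousAlternatingMap.map_coord_zero _ 0 (by simp [hi.symm])

end

end Tangent

/-! ### The identities on the manifold -/

section Main

variable {E : Type*} [NormedAddCommGroup E] [NormedSpace ℝ E]
  {H : Type*} [TopologicalSpace H] {I : ModelWithCorners ℝ E H} [I.Boundaryless]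
  {M : Type*} [TopologicalSpace M] [ChartedSpace H M] [IsManifold I ∞ M] {p : ℕ}

theorem completeLift_isSmooth {α : Form I M p} (hα : α.IsSmooth) : (completeLift α).IsSmooth := by
  intro u₀
  rw [tangent_target_eq]
  refine (contDiffOn_liftForm (isOpen_extChartAt_target u₀.proj) (hα u₀.proj)).congr fun z hz => ?_
  rw [← tangent_target_eq] at hz
  exact completeLift_inChart hα hz

theorem interior_tautological_isSmooth {α : Form I M (p + 1)} (hα : α.IsSmooth) :
    ((completeLift α).interior (tautological I M)).IsSmooth := by
  intro u₀
  rw [tangent_target_eq]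
  refine (contDiffOn_contractForm (hα u₀.proj)).congr fun z hz => ?_
  rw [← tangent_target_eq] at hz
  exact interior_tautological_inChart hα hz

theorem eventually_mem_tangent_target (u : TangentBundle I M) :
    ∀ᶠ z in 𝓝 (extChartAt I.tangent u u), z ∈ (extChartAt I.tangent u).target :=
  extChartAt_target_mem_nhds u

theorem mirror_value (u : TangentBundle I M) : endValue (mirror I M) u = mirrorModel E := by
  have h := mirror_inChart (mem_extChartAt_target (I := I.tangent) u)
  rwa [extChartAt_to_inv, chartD_self, symmD_self, ContinuousLinearMap.id_comp,
    ContinuousLinearMap.comp_id] at h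

/-- The outer `i_B` is pointwise and needs only the value of `B` at `u`; the inner one sits under
`d` and needs the coordinate expression near `u`, given by `insert_mirror_inChart`. -/
theorem dB_value (η : Form I.tangent (TangentBundle I M) p) (u : TangentBundle I M) :
    (dB η).value u = (η.d.value u).fderivCompContinuousLinearMap
      (ContinuousLinearMap.id ℝ (E × E)) (mirrorModel E) - (η.insert (mirror I M)).d.value u := by
  rw [← mirror_value u]
  rfl

theorem insert_mirror_inChart (η : Form I.tangent (TangentBundle I M) p) {u₀ : TangentBundle I M}
    {z : E × E} (hz : z ∈ (extChartAt I.tangent u₀).target) :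
    (η.insert (mirror I M)).inChart u₀ z = (η.inChart u₀ z).fderivCompContinuousLinearMap
      (ContinuousLinearMap.id ℝ (E × E)) (mirrorModel E) :=
  η.inChart_insert hz (mirror_inChart hz)

theorem pullback_value (α : Form I M p) (u : TangentBundle I M) :
    (pullback α).value u = pullForm (α.inChart u.proj) (extChartAt I.tangent u u) := by
  rw [Form.value_eq_inChart, pullback_inChart α (mem_extChartAt_target u)]

theorem d_interior_tautological_value {α : Form I M (p + 1)} (hα : α.IsSmooth)
    (u : TangentBundle I M) :
    ((completeLift α).interior (tautological I M)).d.value u =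
      liftForm (α.inChart u.proj) (extChartAt I.tangent u u) -
        contractForm (extDeriv (α.inChart u.proj)) (extChartAt I.tangent u u) := by
  rw [Form.d_value _ ((eventually_mem_tangent_target u).mono fun z hz =>
    interior_tautological_inChart hα hz)]
  exact extDeriv_contractForm (hα.differentiableAt_inChart u.proj)

theorem d_completeLift_value {α : Form I M p} (hα : α.IsSmooth) (u : TangentBundle I M) :
    (completeLift α).d.value u =
      liftForm (extDeriv (α.inChart u.proj)) (extChartAt I.tangent u u) := by
  rw [Form.d_value _ ((eventually_mem_tangent_target u).mono fun z hz =>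
    completeLift_inChart hα hz)]
  exact extDeriv_liftForm (isOpen_extChartAt_target u.proj) (hα u.proj)
    (mem_extChartAt_target u.proj)

theorem d_pullback_value {α : Form I M p} (hα : α.IsSmooth) (u : TangentBundle I M) :
    (pullback α).d.value u =
      pullForm (extDeriv (α.inChart u.proj)) (extChartAt I.tangent u u) := by
  rw [Form.d_value _ ((eventually_mem_tangent_target u).mono fun z hz => pullback_inChart α hz)]
  exact extDeriv_pullForm (hα.differentiableAt_inChart u.proj)

theorem dB_interior_tautological {α : Form I M (p + 1)} (hα : α.IsSmooth) :
    dB ((completeLift α).interior (tautological I M)) = ((p : ℝ) + 1) • pullback α := by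
  refine Form.ext_value fun u => ?_
  -- Zero is written as a multiple `0 • _` so that `extDeriv_smul` makes its derivative vanish.
  have h0 : (((completeLift α).interior (tautological I M)).insert (mirror I M)).inChart u
      =ᶠ[𝓝 (extChartAt I.tangent u u)] (0 : ℝ) • pullForm 0 := by
    filter_upwards [eventually_mem_tangent_target u] with z hz
    rw [insert_mirror_inChart _ hz, interior_tautological_inChart hα hz,
      insert_mirrorModel_contractForm, zero_smul]
    rfl
  have hsub : ∀ f g : (E × E) [⋀^Fin (p + 1)]→L[ℝ] ℝ, (f - g).fderivCompContinuousLinearMap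
      (ContinuousLinearMap.id ℝ (E × E)) (mirrorModel E) = f.fderivCompContinuousLinearMap
      (ContinuousLinearMap.id ℝ (E × E)) (mirrorModel E) - g.fderivCompContinuousLinearMap
      (ContinuousLinearMap.id ℝ (E × E)) (mirrorModel E) := fun f g => by
    ext X
    simp
  have h1 : (((p : ℝ) + 1) • pullback α).value u = ((p : ℝ) + 1) • (pullback α).value u := rfl
  rw [dB_value, d_interior_tautological_value hα, Form.d_value _ h0, extDeriv_smul, zero_smul,
    sub_zero, hsub, insert_mirrorModel_contractForm, sub_zero, insert_mirrorModel_liftForm, h1,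
    pullback_value]
  push_cast
  rfl

theorem dB_completeLift {α : Form I M p} (hα : α.IsSmooth) :
    dB (completeLift α) = (pullback α).d := by
  refine Form.ext_value fun u => ?_
  have h0 : ((completeLift α).insert (mirror I M)).inChart u
      =ᶠ[𝓝 (extChartAt I.tangent u u)] (p : ℝ) • pullForm (α.inChart u.proj) := by
    filter_upwards [eventually_mem_tangent_target u] with z hz
    rw [insert_mirror_inChart _ hz, completeLift_inChart hα hz, insert_mirrorModel_liftForm]
    rfl
  have h1 : extDeriv (pullForm (α.inChart u.proj)) (extChartAt I.tangent u u) = _ :=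
    extDeriv_pullForm (hα.differentiableAt_inChart u.proj)
  -- The coefficients are `p + 1`, from the lift of the `(p + 1)`-form `dη`, and `p`, from inserting
  -- `B` before differentiating; their difference is `1`.
  rw [dB_value, d_completeLift_value hα, Form.d_value _ h0, extDeriv_smul, h1,
    insert_mirrorModel_liftForm, d_pullback_value hα, ← sub_smul]
  simp

theorem extDeriv_inChart_of_d_eq_zero {α : Form I M p} (h : α.d = 0) (x : M) :
    extDeriv (α.inChart x) (extChartAt I x x) = 0 := by
  rw [← α.d_value (Filter.EventuallyEq.refl _ _), h]
  rfl

theorem contractForm_extDeriv_of_d_eq_zero {α : Form I M p} (h : α.d = 0)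
    (u : TangentBundle I M) :
    contractForm (extDeriv (α.inChart u.proj)) (extChartAt I.tangent u u) = 0 := by
  have h1 : extDeriv (α.inChart u.proj) (extChartAt I.tangent u u).1 = 0 :=
    extDeriv_inChart_of_d_eq_zero h u.proj
  ext X
  rw [contractForm_apply, h1]
  rfl

theorem d_interior_tautological_of_d_eq_zero {α : Form I M (p + 1)} (hα : α.IsSmooth)
    (h : α.d = 0) :
    ((completeLift α).interior (tautological I M)).d = completeLift α := by
  refine Form.ext_value fun u => ?_
  rw [d_interior_tautological_value hα, completeLift_value,
    contractForm_extDeriv_of_d_eq_zero h, sub_zero]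

theorem completeLift_eq_zero_of_d_eq_zero {f : Form I M 0} (h : f.d = 0) : completeLift f = 0 := by
  refine Form.ext_value fun u => ?_
  rw [completeLift_value, liftForm_eq_contractForm_extDeriv, contractForm_extDeriv_of_d_eq_zero h]
  rfl

theorem exists_dB_eq_pullback {α : Form I M (p + 1)} (hα : α.IsSmooth) :
    ∃ η : Form I.tangent (TangentBundle I M) p, η.IsSmooth ∧ dB η = pullback α := by
  -- Normalising `α` before lifting lets the earlier lemmas apply directly, with no appeal to
  -- linearity of `dB` or of the lift.
  have hc := hα.const_smul (((p : ℝ) + 1)⁻¹)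
  refine ⟨_, interior_tautological_isSmooth hc, ?_⟩
  have h : pullback ((((p : ℝ) + 1)⁻¹) • α) = (((p : ℝ) + 1)⁻¹) • pullback α := rfl
  rw [dB_interior_tautological hc, h, smul_smul, mul_inv_cancel₀ (by positivity), one_smul]

end Main

end TangentForms

end

theorem mainTheorem5 (m : ℕ) {M : Type*} [TopologicalSpace M]
    [ChartedSpace (EuclideanSpace ℝ (Fin m)) M] [IsManifold (𝓡 m) ∞ M] :
    -- for forms of degree `p + 1`
    (∀ (p : ℕ) (α : TangentForms.Form (𝓡 m) M (p + 1)), α.IsSmooth →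
      ((TangentForms.completeLift α).interior (TangentForms.tautological (𝓡 m) M)).IsSmooth ∧
      TangentForms.dB
          ((TangentForms.completeLift α).interior (TangentForms.tautological (𝓡 m) M)) =
        ((p : ℝ) + 1) • TangentForms.pullback α ∧
      ∃ η : TangentForms.Form (𝓡 m).tangent (TangentBundle (𝓡 m) M) p,
        η.IsSmooth ∧ TangentForms.dB η = TangentForms.pullback α) ∧
    -- in every degree
    (∀ (p : ℕ) (α : TangentForms.Form (𝓡 m) M p), α.IsSmooth →
      (TangentForms.completeLift α).IsSmooth ∧
      TangentForms.dB (TangentForms.completeLift α) = (TangentForms.pullback α).d) ∧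
    -- closed forms of degree `p + 1`, and functions, whose interior product with `ξ` is `0`
    (∀ (p : ℕ) (α : TangentForms.Form (𝓡 m) M (p + 1)), α.IsSmooth → α.d = 0 →
      ((TangentForms.completeLift α).interior (TangentForms.tautological (𝓡 m) M)).d =
        TangentForms.completeLift α) ∧
    (∀ f : TangentForms.Form (𝓡 m) M 0, f.IsSmooth → f.d = 0 →
      TangentForms.completeLift f = 0) :=
  ⟨fun _ _ hα => ⟨TangentForms.interior_tautological_isSmooth hα,
      TangentForms.dB_interior_tautological hα, TangentForms.exists_dB_eq_pullback hα⟩,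
    fun _ _ hα => ⟨TangentForms.completeLift_isSmooth hα, TangentForms.dB_completeLift hα⟩,
    fun _ _ hα h => TangentForms.d_interior_tautological_of_d_eq_zero hα h,
    fun _ _ h => TangentForms.completeLift_eq_zero_of_d_eq_zero h⟩
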